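/- Let $0<\alpha<2$, let $(S_1,\mu_1)$ and $(S_2,\mu_2)$ be measure spaces, and for a measurable function $f$ on $S_i$ write $\|f\|_{L^\alpha(S_i,\mu_i)}=\left(\int_{S_i}|f|^\alpha\,d\mu_i\right)^{1/\alpha}$. For $i=1,2$ let $f^{(i)}_1,\dots,f^{(i)}_n\in L^\alpha_+(S_i,\mu_i)$, that is, real functions in $L^\alpha(S_i,\mu_i)$ that are nonnegative $\mu_i$-almost everywhere. Then $$\Big\|\sum_{j=1}^n a_j f^{(1)}_j\Big\|_{L^\alpha(S_1,\mu_1)}=\Big\|\sum_{j=1}^n a_j f^{(2)}_j\Big\|_{L^\alpha(S_2,\mu_2)}\quad\text{for all } a_1,\dots,a_n\in\mathbb R$$ if and only if $$\Big\|\bigvee_{j=1}^n a_j f^{(1)}_j\Big\|_{L^\alpha(S_1,\mu_1)}=\Big\|\bigvee_{j=1}^n a_j f^{(2)}_j\Big\|_{L^\alpha(S_2,\mu_2)}\quad\text{for all } a_1,\dots,a_n\ge 0,$$ where $\bigvee_{j=1}^n$ denotes the pointwise maximum. -/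

import Mathlib

open MeasureTheory

/-!
Write `F i = (f i 1, …, f i n)` and push `μ i ⊗ r ^ (-α - 1) dr` forward under `(s, r) ↦ r • F i s`
to a measure `Λ i` on `ℝⁿ` without mass at the origin (`homogeneousLift`). It is concentrated on the
nonnegative orthant. For a positively homogeneous `h` and a profile `ψ` with `ψ 0 = 0`, scaling in
the radial variable gives
`∫ ψ |h| dΛ i = (∫ ψ r * r ^ (-α - 1) dr) * ∫ |h (F i)| ^ α dμ i`
(`lintegral_homogeneousLift_comp`). If the radial constant is positive and finite, the `α`-norms of
`h ∘ F 1` and `h ∘ F 2` therefore agree exactly when `ψ |h|` has the same integral against `Λ 1`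
and `Λ 2`. Both conditions of the theorem turn out to be equivalent to `Λ 1 = Λ 2`.

* For linear `h`, take `ψ = 1 - cos`, whose radial constant is finite because `0 < α < 2`. Equality
  of the sum norms says that the integrals of `1 - cos (L y)` agree for every linear `L`. As
  `cos (L y) * (1 - cos (M y))` is a combination of such functions, the finite measures
  `cosWeight • Λ i` have the same cosine transform, hence the same symmetrization. Measures on the
  punctured orthant are recovered from their symmetrizations, so `Λ 1 = Λ 2`
  (`eq_of_lintegral_one_sub_cos`).
* For a weighted maximum `h`, take for `ψ` the indicator of `(1, ∞)`. Equality of the maximum norms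
  says that `Λ 1` and `Λ 2` give the same mass to complements of boxes, and these masses determine
  them (`eq_of_measure_compl_Iic`).
-/

open Set
open scoped ENNReal

/-! ### The radial measure -/

/-- The radial measure `r ^ (-α - 1) dr` on the half-line `(0, ∞)`, extended by zero to `ℝ`. -/
noncomputable def radialMeasure (α : ℝ) : Measure ℝ :=
  (volume.restrict (Ioi 0)).withDensity fun r => ENNReal.ofReal (r ^ (-α - 1))

instance (α : ℝ) : SFinite (radialMeasure α) := by
  unfold radialMeasure; infer_instance

lemma lintegral_radialMeasure (α : ℝ) {ψ : ℝ → ℝ≥0∞} (hψ : Measurable ψ) :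
    ∫⁻ r, ψ r ∂radialMeasure α = ∫⁻ r in Ioi 0, ENNReal.ofReal (r ^ (-α - 1)) * ψ r := by
  rw [radialMeasure, lintegral_withDensity_eq_lintegral_mul _ (by fun_prop) hψ]
  rfl

lemma ae_radialMeasure_pos (α : ℝ) : ∀ᵐ r ∂radialMeasure α, 0 < r :=
  (withDensity_absolutelyContinuous _ _).ae_le (ae_restrict_mem measurableSet_Ioi)

/-- Dilation multiplies the radial measure by a power of the dilation factor. -/
lemma lintegral_radialMeasure_comp_mul (α : ℝ) {ψ : ℝ → ℝ≥0∞} (hψ : Measurable ψ) {t : ℝ}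
    (ht : 0 < t) :
    ∫⁻ r, ψ (r * t) ∂radialMeasure α
      = ENNReal.ofReal t ^ α * ∫⁻ r, ψ r ∂radialMeasure α := by
  rw [lintegral_radialMeasure α (by fun_prop), lintegral_radialMeasure α hψ]
  have key := lintegral_image_eq_lintegral_abs_deriv_mul (s := Ioi (0 : ℝ)) (f := fun r => r * t)
    (f' := fun _ => t) measurableSet_Ioi
    (fun x _ => by simpa using ((hasDerivAt_id x).mul_const t).hasDerivWithinAt)
    (fun x _ y _ h => mul_right_cancel₀ ht.ne' h)
    (fun r => ENNReal.ofReal (r ^ (-α - 1)) * ψ r)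
  have him : (fun r => r * t) '' Ioi 0 = Ioi 0 :=
    Subset.antisymm (image_subset_iff.2 fun r (hr : 0 < r) => mul_pos hr ht) fun r (hr : 0 < r) =>
      ⟨r / t, div_pos hr ht, div_mul_cancel₀ r ht.ne'⟩
  rw [him] at key
  rw [key, ← lintegral_const_mul' _ _ (by simp [ENNReal.rpow_eq_top_iff, ht])]
  refine setLIntegral_congr_fun measurableSet_Ioi fun r (hr : 0 < r) => ?_
  simp only [abs_of_pos ht]
  rw [← mul_assoc, ← mul_assoc, ENNReal.ofReal_rpow_of_pos ht, ← ENNReal.ofReal_mul (by positivity),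
    ← ENNReal.ofReal_mul (by positivity), Real.mul_rpow hr.le ht.le]
  congr 2
  have h1 : t * t ^ (-α - 1) * t ^ α = 1 := by
    nth_rewrite 1 [← Real.rpow_one t]
    rw [← Real.rpow_add ht, ← Real.rpow_add ht]
    ring_nf; simp
  linear_combination (-r ^ (-α - 1)) * h1

lemma lintegral_radialMeasure_ne_zero (α : ℝ) {ψ : ℝ → ℝ≥0∞} (hψ : Measurable ψ) {a b : ℝ}
    (ha : 0 ≤ a) (hab : a < b) (h : ∀ r ∈ Ioo a b, ψ r ≠ 0) :
    ∫⁻ r, ψ r ∂radialMeasure α ≠ 0 := by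
  rw [lintegral_radialMeasure α hψ]
  refine (ne_of_gt ?_)
  rw [setLIntegral_pos_iff (by fun_prop)]
  refine lt_of_lt_of_le (b := volume (Ioo a b)) (by simp [hab]) (measure_mono fun r hr => ?_)
  have h0 : 0 < r := ha.trans_lt hr.1
  exact ⟨mul_ne_zero (by simpa using Real.rpow_pos_of_pos h0 _) (h r hr), h0⟩

lemma radialMeasure_Ioi_one_ne_top {α : ℝ} (hα : 0 < α) : radialMeasure α (Ioi 1) ≠ ∞ := by
  rw [radialMeasure, withDensity_apply _ measurableSet_Ioi,
    Measure.restrict_restrict measurableSet_Ioi, inter_eq_left.2 (Ioi_subset_Ioi zero_le_one)]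
  exact (integrableOn_Ioi_rpow_of_lt (by linarith) one_pos).setLIntegral_lt_top.ne

/-- Near `0` the integrand is at most `r ^ (1 - α)`, integrable because `α < 2`; near infinity it is
at most `2 * r ^ (-α - 1)`, integrable because `0 < α`. -/
lemma lintegral_radialMeasure_one_sub_cos_ne_top {α : ℝ} (hα : 0 < α) (hα₂ : α < 2) :
    ∫⁻ r, ENNReal.ofReal (1 - Real.cos r) ∂radialMeasure α ≠ ∞ := by
  rw [lintegral_radialMeasure α (by fun_prop), ← Ioc_union_Ioi_eq_Ioi zero_le_one]
  refine ne_top_of_le_ne_top (ENNReal.add_ne_top.2 ⟨?_, ?_⟩) (lintegral_union_le _ _ _)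
  · have h : IntegrableOn (fun r : ℝ => r ^ (1 - α)) (Ioc 0 1) := by
      have := (intervalIntegral.intervalIntegrable_rpow' (a := 0) (b := 1) (r := 1 - α)
        (by linarith))
      rwa [intervalIntegrable_iff_integrableOn_Ioc_of_le zero_le_one] at this
    refine ne_top_of_le_ne_top h.setLIntegral_lt_top.ne
      (setLIntegral_mono' measurableSet_Ioc fun r hr => ?_)
    rw [← ENNReal.ofReal_mul (by have := hr.1; positivity)]
    refine ENNReal.ofReal_le_ofReal ?_
    have h2 : r ^ (1 - α) = r ^ (-α - 1) * r ^ 2 := by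
      rw [← Real.rpow_natCast, ← Real.rpow_add hr.1]
      norm_num; ring_nf
    rw [h2]
    have := Real.one_sub_sq_div_two_le_cos (x := r)
    exact mul_le_mul_of_nonneg_left (by nlinarith [sq_nonneg r]) (Real.rpow_nonneg hr.1.le _)
  · have h := (integrableOn_Ioi_rpow_of_lt (a := -α - 1) (by linarith) one_pos).const_mul 2
    refine ne_top_of_le_ne_top (IntegrableOn.setLIntegral_lt_top h).ne
      (setLIntegral_mono' measurableSet_Ioi fun r (hr : 1 < r) => ?_)
    have h0 : 0 < r := by linarith
    rw [← ENNReal.ofReal_mul (by positivity)]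
    refine ENNReal.ofReal_le_ofReal ?_
    rw [mul_comm]
    exact mul_le_mul_of_nonneg_right (by linarith [Real.neg_one_le_cos r])
      (Real.rpow_nonneg h0.le _)

section

variable {ι : Type*} [Fintype ι]

/-! ### Homogeneous lift of a measure -/

/-- The image of `ν ⊗ r ^ (-α - 1) dr` under `(x, r) ↦ r • x`, with the mass at the origin removed.
It is written as a `bind` rather than as a product, so that `ν` need not be s-finite. -/
noncomputable def homogeneousLift (α : ℝ) (ν : Measure (ι → ℝ)) : Measure (ι → ℝ) :=
  (ν.bind fun x => (radialMeasure α).map fun r => r • x).restrict {0}ᶜ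

lemma measurable_map_smul_radialMeasure (α : ℝ) :
    Measurable fun x : ι → ℝ => (radialMeasure α).map fun r => r • x := by
  refine Measure.measurable_of_measurable_coe _ fun s hs => ?_
  have h : ∀ x : ι → ℝ, (radialMeasure α).map (fun r => r • x) s
      = radialMeasure α (Prod.mk x ⁻¹' ((fun p : (ι → ℝ) × ℝ => p.2 • p.1) ⁻¹' s)) := fun x => by
    rw [Measure.map_apply (by fun_prop) hs]; rfl
  simp_rw [h]
  exact measurable_measure_prodMk_left (hs.preimage (by fun_prop))

lemma lintegral_homogeneousLift (α : ℝ) (ν : Measure (ι → ℝ)) {φ : (ι → ℝ) → ℝ≥0∞}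
    (hφ : Measurable φ) (h0 : φ 0 = 0) :
    ∫⁻ y, φ y ∂homogeneousLift α ν = ∫⁻ x, ∫⁻ r, φ (r • x) ∂radialMeasure α ∂ν := by
  rw [homogeneousLift, ← lintegral_indicator (measurableSet_singleton 0).compl,
    show ({0}ᶜ : Set (ι → ℝ)).indicator φ = φ from ?_,
    Measure.lintegral_bind (measurable_map_smul_radialMeasure α).aemeasurable hφ.aemeasurable]
  · congr with x
    rw [lintegral_map hφ (by fun_prop)]
  · rw [indicator_eq_self]
    intro x hx h
    exact hx (by rw [h, h0])

/-- Integrating a function of `|h|` against the lift, for `h` positively homogeneous, separates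
into a radial constant and the `α`-th moment of `h`. -/
lemma lintegral_homogeneousLift_comp {α : ℝ} (hα : 0 < α) (ν : Measure (ι → ℝ))
    {h : (ι → ℝ) → ℝ} (hh : Measurable h) (hom : ∀ r x, 0 ≤ r → h (r • x) = r * h x)
    {ψ : ℝ → ℝ≥0∞} (hψ : Measurable ψ) (h0 : ψ 0 = 0) :
    ∫⁻ y, ψ |h y| ∂homogeneousLift α ν
      = (∫⁻ r, ψ r ∂radialMeasure α) * ∫⁻ x, ‖h x‖ₑ ^ α ∂ν := by
  have hz : h 0 = 0 := by simpa using hom 0 0 le_rfl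
  rw [lintegral_homogeneousLift α ν (φ := fun y => ψ |h y|) (by fun_prop) (by simp [hz, h0]),
    ← lintegral_const_mul _ (by fun_prop)]
  congr with x
  have h1 : ∀ᵐ r ∂radialMeasure α, ψ |h (r • x)| = ψ (r * |h x|) := by
    filter_upwards [ae_radialMeasure_pos α] with r hr
    rw [hom r x hr.le, abs_mul, abs_of_pos hr]
  rw [lintegral_congr_ae h1, Real.enorm_eq_ofReal_abs]
  rcases (abs_nonneg (h x)).eq_or_lt with hx | hx
  · simp [← hx, h0, hα]
  · rw [lintegral_radialMeasure_comp_mul α hψ hx, mul_comm]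

lemma homogeneousLift_nonneg (α : ℝ) {ν : Measure (ι → ℝ)} (hν : ∀ᵐ x ∂ν, 0 ≤ x) :
    ∀ᵐ y ∂homogeneousLift α ν, 0 ≤ y := by
  have hm : MeasurableSet {y : ι → ℝ | ¬ 0 ≤ y} := (measurableSet_Ici (a := (0 : ι → ℝ))).compl
  rw [ae_iff, ← lintegral_indicator_one hm, lintegral_homogeneousLift α ν
    (measurable_one.indicator hm) (by simp), lintegral_eq_zero_iff']
  · filter_upwards [hν] with x hx
    refine lintegral_eq_zero_of_ae_eq_zero ?_
    filter_upwards [ae_radialMeasure_pos α] with r hr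
    simp [smul_nonneg hr.le hx]
  · refine (Measurable.lintegral_prod_right' (f := fun p : (ι → ℝ) × ℝ =>
      ({y : ι → ℝ | ¬ 0 ≤ y}.indicator 1 (p.2 • p.1) : ℝ≥0∞)) ?_).aemeasurable
    exact (measurable_one.indicator hm).comp (by fun_prop)

lemma homogeneousLift_ne_zero (α : ℝ) (ν : Measure (ι → ℝ)) :
    ∀ᵐ y ∂homogeneousLift α ν, y ≠ 0 :=
  ae_restrict_mem (measurableSet_singleton 0).compl

/-! ### Uniqueness from the integrals of `1 - cos` -/

/-- The cosine transform of a finite measure determines its symmetrization, whose characteristic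
function it is up to the factor `2`. -/
lemma add_map_neg_eq_of_integral_cos {E : Type*} [NormedAddCommGroup E] [NormedSpace ℝ E]
    [CompleteSpace E] [SecondCountableTopology E] [MeasurableSpace E] [BorelSpace E]
    {m₁ m₂ : Measure E} [IsFiniteMeasure m₁] [IsFiniteMeasure m₂]
    (h : ∀ L : StrongDual ℝ E, ∫ y, Real.cos (L y) ∂m₁ = ∫ y, Real.cos (L y) ∂m₂) :
    m₁ + m₁.map (fun y => -y) = m₂ + m₂.map (fun y => -y) := by
  have key : ∀ (m : Measure E) [IsFiniteMeasure m] (L : StrongDual ℝ E),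
      charFunDual (m + m.map (fun y => -y)) L = ((2 * ∫ y, Real.cos (L y) ∂m : ℝ) : ℂ) := by
    intro m _ L
    have hi : ∀ m' : Measure E, IsFiniteMeasure m' →
        Integrable (fun y => Complex.exp (L y * Complex.I)) m' := fun m' _ =>
      (integrable_const (1 : ℝ)).mono' (by fun_prop)
        (.of_forall fun y => by simp [Complex.norm_exp_ofReal_mul_I])
    have hi' : Integrable (fun y => Complex.exp (L (-y) * Complex.I)) m :=
      (integrable_const (1 : ℝ)).mono' (by fun_prop)
        (.of_forall fun y => by simp only [Complex.norm_exp_ofReal_mul_I, le_refl])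
    rw [charFunDual_apply, integral_add_measure (hi _ inferInstance) (hi _ inferInstance),
      integral_map (by fun_prop) (by fun_prop), ← integral_add (hi _ inferInstance) hi',
      ← integral_const_mul, ← integral_complex_ofReal]
    congr with y
    push_cast
    rw [Complex.two_cos]
    simp
  refine Measure.ext_of_charFunDual (funext fun L => ?_)
  rw [key, key, h]

/-- Symmetrization loses nothing on the nonnegative orthant, which meets its reflection only at the
origin. -/
lemma eq_of_add_map_neg_eq {m₁ m₂ : Measure (ι → ℝ)}
    (hz₁ : ∀ᵐ y ∂m₁, y ≠ 0) (hz₂ : ∀ᵐ y ∂m₂, y ≠ 0)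
    (hp₁ : ∀ᵐ y ∂m₁, 0 ≤ y) (hp₂ : ∀ᵐ y ∂m₂, 0 ≤ y)
    (h : m₁ + m₁.map (fun y => -y) = m₂ + m₂.map (fun y => -y)) : m₁ = m₂ := by
  have key : ∀ m : Measure (ι → ℝ), (∀ᵐ y ∂m, y ≠ 0) → (∀ᵐ y ∂m, 0 ≤ y) →
      ∀ s, MeasurableSet s → (m + m.map (fun y => -y)) (s ∩ (Ici 0 \ {0})) = m s := by
    intro m hz hp s hs
    have hm : MeasurableSet (s ∩ (Ici (0 : ι → ℝ) \ {0})) :=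
      hs.inter (measurableSet_Ici.diff (measurableSet_singleton 0))
    have h1 : m (s ∩ (Ici 0 \ {0})) = m s := by
      refine measure_congr ?_
      filter_upwards [hz, hp] with y hy1 hy2
      exact propext ⟨fun h => h.1, fun h => ⟨h, hy2, hy1⟩⟩
    have h2 : m ((fun y => -y) ⁻¹' (s ∩ (Ici 0 \ {0}))) = 0 := by
      refine measure_mono_null (t := {y | ¬ (y ≠ 0 ∧ 0 ≤ y)}) ?_ (ae_iff.1 (hz.and hp))
      rintro y ⟨_, hy, hy0⟩ ⟨_, h4⟩
      exact hy0 (le_antisymm (neg_nonpos.2 h4) hy)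
    rw [Measure.add_apply, Measure.map_apply measurable_neg hm, h1, h2, add_zero]
  ext s hs
  rw [← key m₁ hz₁ hp₁ s hs, h, key m₂ hz₂ hp₂ s hs]

/-- A bounded continuous weight on `ι → ℝ`, built from functions `1 - cos (L y)` with `L` linear.
It vanishes only at the origin, since no nonzero real `t` has both `t` and `√2 * t` in `2πℤ`. -/
noncomputable def cosWeight (y : ι → ℝ) : ℝ :=
  ∑ j, ((1 - Real.cos (y j)) + (1 - Real.cos (√2 * y j)))

lemma measurable_cosWeight : Measurable (cosWeight (ι := ι)) := by
  unfold cosWeight; fun_prop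

lemma cosWeight_nonneg (y : ι → ℝ) : 0 ≤ cosWeight y :=
  Finset.sum_nonneg fun j _ => by
    linarith [Real.cos_le_one (y j), Real.cos_le_one (√2 * y j)]

lemma cosWeight_pos {y : ι → ℝ} (hy : y ≠ 0) : 0 < cosWeight y := by
  refine (cosWeight_nonneg y).lt_of_ne' fun h => hy (funext fun j => ?_)
  rw [cosWeight, Finset.sum_eq_zero_iff_of_nonneg fun j _ => by
    linarith [Real.cos_le_one (y j), Real.cos_le_one (√2 * y j)]] at h
  have hj := h j (Finset.mem_univ j)
  have h1 : Real.cos (y j) = 1 := by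
    linarith [Real.cos_le_one (y j), Real.cos_le_one (√2 * y j)]
  have h2 : Real.cos (√2 * y j) = 1 := by linarith
  obtain ⟨k, hk⟩ := (Real.cos_eq_one_iff _).1 h1
  obtain ⟨l, hl⟩ := (Real.cos_eq_one_iff _).1 h2
  by_contra hne
  have hk0 : (k : ℝ) ≠ 0 := fun h0 => hne (by rw [← hk, h0]; simp)
  refine irrational_sqrt_two ⟨(l : ℚ) / k, ?_⟩
  push_cast
  rw [div_eq_iff hk0]
  have : (l : ℝ) * (2 * Real.pi) = √2 * k * (2 * Real.pi) := by rw [hl, ← hk]; ring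
  exact mul_right_cancel₀ (by positivity) this

lemma integral_cos_mul_cosWeight {m₁ m₂ : Measure (ι → ℝ)}
    (hi₁ : ∀ L : StrongDual ℝ (ι → ℝ), Integrable (fun y => 1 - Real.cos (L y)) m₁)
    (hi₂ : ∀ L : StrongDual ℝ (ι → ℝ), Integrable (fun y => 1 - Real.cos (L y)) m₂)
    (h : ∀ L : StrongDual ℝ (ι → ℝ),
      ∫ y, (1 - Real.cos (L y)) ∂m₁ = ∫ y, (1 - Real.cos (L y)) ∂m₂)
    (L : StrongDual ℝ (ι → ℝ)) :
    ∫ y, Real.cos (L y) * cosWeight y ∂m₁ = ∫ y, Real.cos (L y) * cosWeight y ∂m₂ := by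
  -- `cos a * (1 - cos b)` is a linear combination of values of `1 - cos`.
  have hcos : ∀ (M : StrongDual ℝ (ι → ℝ)) (y : ι → ℝ), Real.cos (L y) * (1 - Real.cos (M y)) =
      2⁻¹ * ((1 - Real.cos ((L + M) y)) + (1 - Real.cos ((L - M) y))) - (1 - Real.cos (L y)) := by
    intro M y
    simp only [_root_.add_apply, _root_.sub_apply, Real.cos_add,
      Real.cos_sub]
    ring
  have hI : ∀ (m : Measure (ι → ℝ)),
      (∀ L : StrongDual ℝ (ι → ℝ), Integrable (fun y => 1 - Real.cos (L y)) m) →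
      ∀ M : StrongDual ℝ (ι → ℝ),
        Integrable (fun y => Real.cos (L y) * (1 - Real.cos (M y))) m ∧
        ∫ y, Real.cos (L y) * (1 - Real.cos (M y)) ∂m =
          2⁻¹ * ((∫ y, (1 - Real.cos ((L + M) y)) ∂m) + ∫ y, (1 - Real.cos ((L - M) y)) ∂m)
            - ∫ y, (1 - Real.cos (L y)) ∂m := by
    intro m hm M
    simp only [hcos M]
    have hadd : Integrable
        (fun y => (1 - Real.cos ((L + M) y)) + (1 - Real.cos ((L - M) y))) m := (hm _).add (hm _)
    refine ⟨(hadd.const_mul _).sub (hm _), ?_⟩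
    rw [integral_sub (hadd.const_mul _) (hm _), integral_const_mul,
      integral_add (hm _) (hm _)]
  have hM : ∀ M : StrongDual ℝ (ι → ℝ), ∫ y, Real.cos (L y) * (1 - Real.cos (M y)) ∂m₁ =
      ∫ y, Real.cos (L y) * (1 - Real.cos (M y)) ∂m₂ := fun M => by
    rw [(hI m₁ hi₁ M).2, (hI m₂ hi₂ M).2, h, h, h]
  let p (j : ι) : StrongDual ℝ (ι → ℝ) := ContinuousLinearMap.proj j
  have hw : ∀ m : Measure (ι → ℝ),
      (∀ L : StrongDual ℝ (ι → ℝ), Integrable (fun y => 1 - Real.cos (L y)) m) →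
      ∫ y, Real.cos (L y) * cosWeight y ∂m =
        ∑ j, ((∫ y, Real.cos (L y) * (1 - Real.cos (p j y)) ∂m) +
          ∫ y, Real.cos (L y) * (1 - Real.cos ((√2 • p j) y)) ∂m) := by
    intro m hm
    have hadd (j : ι) : Integrable (fun y => Real.cos (L y) * (1 - Real.cos (p j y)) +
        Real.cos (L y) * (1 - Real.cos ((√2 • p j) y))) m := (hI m hm _).1.add (hI m hm _).1
    simp_rw [← integral_add (hI m hm _).1 (hI m hm _).1]
    rw [← integral_finsetSum _ fun j _ => hadd j]
    simp [cosWeight, Finset.mul_sum, mul_add, p]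
  simp_rw [hw m₁ hi₁, hw m₂ hi₂, hM]

/-- A possibly infinite measure on the punctured nonnegative orthant is determined by the integrals
of `1 - cos (L y)`, provided they are finite: weighted by `cosWeight` it becomes a finite measure
with known cosine transform, and the weight can be divided out. -/
theorem eq_of_lintegral_one_sub_cos {m₁ m₂ : Measure (ι → ℝ)}
    (hz₁ : ∀ᵐ y ∂m₁, y ≠ 0) (hz₂ : ∀ᵐ y ∂m₂, y ≠ 0)
    (hp₁ : ∀ᵐ y ∂m₁, 0 ≤ y) (hp₂ : ∀ᵐ y ∂m₂, 0 ≤ y)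
    (hfin : ∀ L : StrongDual ℝ (ι → ℝ), ∫⁻ y, ENNReal.ofReal (1 - Real.cos (L y)) ∂m₁ ≠ ∞)
    (h : ∀ L : StrongDual ℝ (ι → ℝ), ∫⁻ y, ENNReal.ofReal (1 - Real.cos (L y)) ∂m₁ =
      ∫⁻ y, ENNReal.ofReal (1 - Real.cos (L y)) ∂m₂) : m₁ = m₂ := by
  have hnn : ∀ t : ℝ, 0 ≤ 1 - Real.cos t := fun t => by linarith [Real.cos_le_one t]
  have hint : ∀ m : Measure (ι → ℝ),
      (∀ L : StrongDual ℝ (ι → ℝ), ∫⁻ y, ENNReal.ofReal (1 - Real.cos (L y)) ∂m ≠ ∞) →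
      ∀ L : StrongDual ℝ (ι → ℝ), Integrable (fun y => 1 - Real.cos (L y)) m := fun m hm L =>
    (lintegral_ofReal_ne_top_iff_integrable (by fun_prop) (.of_forall fun y => hnn _)).1 (hm L)
  have hi₁ := hint m₁ hfin
  have hi₂ := hint m₂ fun L => h L ▸ hfin L
  have hmeas : Measurable fun y : ι → ℝ => ENNReal.ofReal (cosWeight y) :=
    measurable_cosWeight.ennreal_ofReal
  have hwfin : ∀ m : Measure (ι → ℝ),
      (∀ L : StrongDual ℝ (ι → ℝ), Integrable (fun y => 1 - Real.cos (L y)) m) →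
      IsFiniteMeasure (m.withDensity fun y => ENNReal.ofReal (cosWeight y)) := by
    intro m hm
    refine isFiniteMeasure_withDensity_ofReal (Integrable.hasFiniteIntegral ?_)
    unfold cosWeight
    refine integrable_finsetSum _ fun j _ => ?_
    exact (hm (ContinuousLinearMap.proj (R := ℝ) (φ := fun _ : ι => ℝ) j)).add
      (hm (√2 • ContinuousLinearMap.proj (R := ℝ) (φ := fun _ : ι => ℝ) j))
  have := hwfin m₁ hi₁
  have := hwfin m₂ hi₂
  have hac : ∀ m : Measure (ι → ℝ),
      m.withDensity (fun y => ENNReal.ofReal (cosWeight y)) ≪ m :=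
    fun m => withDensity_absolutelyContinuous _ _
  have heq : m₁.withDensity (fun y => ENNReal.ofReal (cosWeight y)) =
      m₂.withDensity (fun y => ENNReal.ofReal (cosWeight y)) := by
    refine eq_of_add_map_neg_eq ((hac m₁).ae_le hz₁) ((hac m₂).ae_le hz₂) ((hac m₁).ae_le hp₁)
      ((hac m₂).ae_le hp₂) (add_map_neg_eq_of_integral_cos fun L => ?_)
    have hd : ∀ m : Measure (ι → ℝ),
        ∫ y, Real.cos (L y) ∂m.withDensity (fun y => ENNReal.ofReal (cosWeight y)) =
          ∫ y, Real.cos (L y) * cosWeight y ∂m := by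
      intro m
      rw [integral_withDensity_eq_integral_toReal_smul hmeas
        (.of_forall fun y => ENNReal.ofReal_lt_top)]
      congr with y
      rw [ENNReal.toReal_ofReal (cosWeight_nonneg y), smul_eq_mul, mul_comm]
    rw [hd, hd]
    exact integral_cos_mul_cosWeight hi₁ hi₂
      (fun L => by
        rw [integral_eq_lintegral_of_nonneg_ae (.of_forall fun y => hnn _) (by fun_prop),
          integral_eq_lintegral_of_nonneg_ae (.of_forall fun y => hnn _) (by fun_prop), h]) L
  have hinv : ∀ m : Measure (ι → ℝ), (∀ᵐ y ∂m, y ≠ 0) →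
      (m.withDensity fun y => ENNReal.ofReal (cosWeight y)).withDensity
        (fun y => (ENNReal.ofReal (cosWeight y))⁻¹) = m := by
    intro m hm
    refine withDensity_inv_same hmeas ?_ (.of_forall fun y => ENNReal.ofReal_ne_top)
    filter_upwards [hm] with y hy
    simpa using cosWeight_pos hy
  rw [← hinv m₁ hz₁, heq, hinv m₂ hz₂]

/-! ### Uniqueness from complements of boxes -/

lemma generateFrom_range_Iic_pi :
    MeasurableSpace.generateFrom (range (Iic : (ι → ℝ) → Set (ι → ℝ))) = MeasurableSpace.pi := by
  rw [← generateFrom_eq_pi (C := fun _ : ι => range (Iic : ℝ → Set ℝ))]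
  · congr 1
    ext s
    constructor
    · rintro ⟨b, rfl⟩
      exact ⟨fun j => Iic (b j), fun j _ => ⟨b j, rfl⟩, pi_univ_Iic b⟩
    · rintro ⟨t, ht, rfl⟩
      choose b hb using fun j => ht j (mem_univ j)
      exact ⟨b, by simp only [← pi_univ_Iic, hb]⟩
  · intro _
    rw [← borel_eq_generateFrom_Iic, BorelSpace.measurable_eq (α := ℝ)]
  · intro _
    refine ⟨fun n : ℕ => Iic (n : ℝ), fun n => ⟨n, rfl⟩, ?_⟩
    exact eq_univ_of_forall fun x => mem_iUnion.2 (exists_nat_ge x)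

/-- A finite measure on the nonnegative orthant is determined by its distribution function at
points with positive coordinates. -/
lemma ext_of_Iic_of_nonneg {m₁ m₂ : Measure (ι → ℝ)} [IsFiniteMeasure m₁] [IsFiniteMeasure m₂]
    (hp₁ : ∀ᵐ y ∂m₁, 0 ≤ y) (hp₂ : ∀ᵐ y ∂m₂, 0 ≤ y)
    (h : ∀ b : ι → ℝ, (∀ j, 0 < b j) → m₁ (Iic b) = m₂ (Iic b)) : m₁ = m₂ := by
  have hIic : ∀ b : ι → ℝ, m₁ (Iic b) = m₂ (Iic b) := by
    intro b
    by_cases hb : 0 ≤ b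
    -- Vanishing coordinates of `b` are reached by approximating `b` from above.
    · have hlim : ∀ m : Measure (ι → ℝ), IsFiniteMeasure m →
          Filter.Tendsto (fun k : ℕ => m (Iic (b + fun _ => 1 / ((k : ℝ) + 1)))) Filter.atTop
            (nhds (m (Iic b))) := by
        intro m _
        have hInter : Iic b = ⋂ k : ℕ, Iic (b + fun _ => 1 / ((k : ℝ) + 1)) := by
          refine Subset.antisymm (subset_iInter fun k => Iic_subset_Iic.2 ?_) fun y hy j => ?_
          · exact le_add_of_nonneg_right fun j => by positivity
          · refine ge_of_tendsto' (by
              simpa using (tendsto_one_div_add_atTop_nhds_zero_nat (𝕜 := ℝ)).const_add (b j))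
              fun k => mem_iInter.1 hy k j
        rw [hInter]
        refine tendsto_measure_iInter_atTop (fun k => measurableSet_Iic.nullMeasurableSet) ?_
          ⟨0, measure_ne_top _ _⟩
        intro k l hkl
        refine Iic_subset_Iic.2 (add_le_add_right (fun j => ?_) b)
        exact one_div_le_one_div_of_le (by positivity) (by exact_mod_cast Nat.succ_le_succ hkl)
      refine tendsto_nhds_unique (hlim m₁ inferInstance) ?_
      refine (hlim m₂ inferInstance).congr fun k => (h _ fun j => ?_).symm
      exact add_pos_of_nonneg_of_pos (hb j) (by positivity)
    · have hnull : ∀ m : Measure (ι → ℝ), (∀ᵐ y ∂m, 0 ≤ y) → m (Iic b) = 0 := fun m hm =>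
        measure_mono_null (t := {y | ¬ 0 ≤ y}) (fun y (hy : y ≤ b) h0 => hb (le_trans h0 hy))
          (ae_iff.1 hm)
      rw [hnull m₁ hp₁, hnull m₂ hp₂]
  refine Measure.ext_of_generateFrom_of_iUnion (range Iic) (fun n : ℕ => Iic fun _ => (n : ℝ))
    generateFrom_range_Iic_pi.symm ?_ ?_ (fun n => ⟨_, rfl⟩)
    (fun n => measure_ne_top _ _) ?_
  · rintro _ ⟨a, rfl⟩ _ ⟨b, rfl⟩ _
    exact ⟨a ⊓ b, Iic_inter_Iic.symm⟩
  · refine eq_univ_of_forall fun y => mem_iUnion.2 ?_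
    obtain ⟨n, hn⟩ := exists_nat_ge ‖y‖
    exact ⟨n, fun j => (le_abs_self _).trans ((norm_le_pi_norm y j).trans hn)⟩
  · rintro _ ⟨b, rfl⟩
    exact hIic b

/-- A possibly infinite measure on the punctured nonnegative orthant is determined by the masses of
complements of boxes, provided they are finite. -/
theorem eq_of_measure_compl_Iic {m₁ m₂ : Measure (ι → ℝ)}
    (hz₁ : ∀ᵐ y ∂m₁, y ≠ 0) (hz₂ : ∀ᵐ y ∂m₂, y ≠ 0)
    (hp₁ : ∀ᵐ y ∂m₁, 0 ≤ y) (hp₂ : ∀ᵐ y ∂m₂, 0 ≤ y)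
    (hfin : ∀ b : ι → ℝ, (∀ j, 0 < b j) → m₁ (Iic b)ᶜ ≠ ∞)
    (h : ∀ b : ι → ℝ, (∀ j, 0 < b j) → m₁ (Iic b)ᶜ = m₂ (Iic b)ᶜ) : m₁ = m₂ := by
  -- Complements of small cubes exhaust the punctured orthant, and the measures are finite there.
  have hU : ∀ m : Measure (ι → ℝ), (∀ᵐ y ∂m, y ≠ 0) → (∀ᵐ y ∂m, 0 ≤ y) →
      m.restrict (⋃ k : ℕ, (Iic fun _ : ι => 1 / ((k : ℝ) + 1))ᶜ) = m := by
    intro m hz hp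
    refine Measure.restrict_eq_self_of_ae_mem ?_
    filter_upwards [hz, hp] with y hy hy0
    by_contra hcon
    simp only [mem_iUnion, mem_compl_iff, not_exists, not_not] at hcon
    refine hy (le_antisymm (fun j => ?_) hy0)
    exact ge_of_tendsto' (tendsto_one_div_add_atTop_nhds_zero_nat (𝕜 := ℝ)) fun k => hcon k j
  rw [← hU m₁ hz₁ hp₁, ← hU m₂ hz₂ hp₂, Measure.restrict_iUnion_congr]
  intro k
  set c : ι → ℝ := fun _ => 1 / ((k : ℝ) + 1)
  have hc : ∀ j, 0 < c j := fun j => by positivity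
  have hfin₂ : ∀ b : ι → ℝ, (∀ j, 0 < b j) → m₂ (Iic b)ᶜ ≠ ∞ := fun b hb => h b hb ▸ hfin b hb
  have : IsFiniteMeasure (m₁.restrict (Iic c)ᶜ) := isFiniteMeasure_restrict.2 (hfin c hc)
  have : IsFiniteMeasure (m₂.restrict (Iic c)ᶜ) := isFiniteMeasure_restrict.2 (hfin₂ c hc)
  refine ext_of_Iic_of_nonneg (ae_restrict_of_ae hp₁) (ae_restrict_of_ae hp₂) fun b hb => ?_
  have hcb : ∀ j, 0 < (c ⊓ b) j := fun j => lt_min (hc j) (hb j)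
  -- The part of a box outside a smaller one is a difference of two complements of boxes.
  have hset : Iic b ∩ (Iic c)ᶜ = (Iic (c ⊓ b))ᶜ \ (Iic b)ᶜ := by
    ext y; simp only [mem_inter_iff, mem_sdiff, mem_compl_iff, mem_Iic, le_inf_iff]; tauto
  have hsub : (Iic b)ᶜ ⊆ (Iic (c ⊓ b))ᶜ := compl_subset_compl.2 (Iic_subset_Iic.2 inf_le_right)
  rw [Measure.restrict_apply measurableSet_Iic, Measure.restrict_apply measurableSet_Iic, hset,
    measure_sdiff hsub measurableSet_Iic.compl.nullMeasurableSet (hfin b hb),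
    measure_sdiff hsub measurableSet_Iic.compl.nullMeasurableSet (hfin₂ b hb), h _ hb, h _ hcb]

/-! ### Norms of homogeneous functions and the lift -/

lemma eLpNorm_comp_eq_lintegral_map {S : Type*} [MeasurableSpace S] {μ : Measure S} {α : ℝ}
    (hα : 0 < α) {κ : Type*} {F : S → κ → ℝ} (hF : AEMeasurable F μ) {h : (κ → ℝ) → ℝ}
    (hh : Measurable h) :
    eLpNorm (fun s => h (F s)) (ENNReal.ofReal α) μ = (∫⁻ x, ‖h x‖ₑ ^ α ∂μ.map F) ^ (1 / α) := by
  rw [eLpNorm_eq_lintegral_rpow_enorm_toReal (by simpa using hα) ENNReal.ofReal_ne_top,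
    ENNReal.toReal_ofReal hα.le, lintegral_map' (by fun_prop) hF]

/-- Equality of the norms of a positively homogeneous function of two families is equality of the
integrals of `ψ |h|` against the two homogeneous lifts, for any profile `ψ` whose radial integral
is positive and finite. -/
lemma eLpNorm_comp_eq_iff {S₁ S₂ : Type*} [MeasurableSpace S₁] [MeasurableSpace S₂]
    {μ₁ : Measure S₁} {μ₂ : Measure S₂} {α : ℝ} (hα : 0 < α)
    {F₁ : S₁ → ι → ℝ} {F₂ : S₂ → ι → ℝ} (hF₁ : AEMeasurable F₁ μ₁) (hF₂ : AEMeasurable F₂ μ₂)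
    {h : (ι → ℝ) → ℝ} (hh : Measurable h) (hom : ∀ r x, 0 ≤ r → h (r • x) = r * h x)
    {ψ : ℝ → ℝ≥0∞} (hψ : Measurable ψ) (h0 : ψ 0 = 0)
    (hψ0 : ∫⁻ r, ψ r ∂radialMeasure α ≠ 0) (hψt : ∫⁻ r, ψ r ∂radialMeasure α ≠ ∞) :
    eLpNorm (fun s => h (F₁ s)) (ENNReal.ofReal α) μ₁
        = eLpNorm (fun s => h (F₂ s)) (ENNReal.ofReal α) μ₂ ↔
      ∫⁻ y, ψ |h y| ∂homogeneousLift α (μ₁.map F₁)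
        = ∫⁻ y, ψ |h y| ∂homogeneousLift α (μ₂.map F₂) := by
  rw [eLpNorm_comp_eq_lintegral_map hα hF₁ hh, eLpNorm_comp_eq_lintegral_map hα hF₂ hh,
    lintegral_homogeneousLift_comp hα _ hh hom hψ h0,
    lintegral_homogeneousLift_comp hα _ hh hom hψ h0,
    ENNReal.mul_right_inj hψ0 hψt,
    (ENNReal.rpow_left_injective (one_div_ne_zero hα.ne')).eq_iff]

lemma lintegral_homogeneousLift_linear_ne_top {S : Type*} [MeasurableSpace S] {μ : Measure S}
    {α : ℝ} (hα : 0 < α) {f : ι → S → ℝ} (hf : ∀ j, MemLp (f j) (ENNReal.ofReal α) μ)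
    {ψ : ℝ → ℝ≥0∞} (hψ : Measurable ψ) (h0 : ψ 0 = 0)
    (hψt : ∫⁻ r, ψ r ∂radialMeasure α ≠ ∞) (a : ι → ℝ) :
    ∫⁻ y, ψ |∑ j, a j * y j| ∂homogeneousLift α (μ.map fun s j => f j s) ≠ ∞ := by
  have hF : AEMeasurable (fun s j => f j s) μ :=
    aemeasurable_pi_lambda _ fun j => (hf j).aestronglyMeasurable.aemeasurable
  have hfin : eLpNorm (fun s => ∑ j, a j * f j s) (ENNReal.ofReal α) μ ≠ ∞ :=
    (memLp_finsetSum _ fun j _ => (hf j).const_mul (a j)).eLpNorm_ne_top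
  rw [eLpNorm_comp_eq_lintegral_map hα hF (h := fun y => ∑ j, a j * y j) (by fun_prop)] at hfin
  rw [lintegral_homogeneousLift_comp hα _ (h := fun y => ∑ j, a j * y j) (by fun_prop)
    (fun r x _ => by simp [Finset.mul_sum, mul_left_comm]) hψ h0]
  refine ENNReal.mul_ne_top hψt fun htop => hfin ?_
  rw [htop, ENNReal.top_rpow_of_pos (by positivity)]

/-- For empty `ι` the supremum is `0` and the box is the whole space, so both sides fail. -/
lemma lt_abs_iSup_inv_mul_iff {b y : ι → ℝ} (hb : ∀ j, 0 < b j) (hy : 0 ≤ y) :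
    1 < |⨆ j, (b j)⁻¹ * y j| ↔ y ∈ (Iic b)ᶜ := by
  rw [abs_of_nonneg (Real.iSup_nonneg fun j => mul_nonneg (inv_nonneg.2 (hb j).le) (hy j)),
    mem_compl_iff, mem_Iic, ← not_le, not_iff_not]
  refine ⟨fun h j => ?_, fun h => Real.iSup_le (fun j => ?_) zero_le_one⟩
  · exact (inv_mul_le_one₀ (hb j)).1
      ((le_ciSup (f := fun j => (b j)⁻¹ * y j) (finite_range _).bddAbove j).trans h)
  · exact (inv_mul_le_one₀ (hb j)).2 (h j)

lemma lintegral_indicator_iSup {m : Measure (ι → ℝ)} (hm : ∀ᵐ y ∂m, 0 ≤ y) {b : ι → ℝ}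
    (hb : ∀ j, 0 < b j) :
    ∫⁻ y, (Ioi (1 : ℝ)).indicator 1 |⨆ j, (b j)⁻¹ * y j| ∂m = m (Iic b)ᶜ := by
  rw [← lintegral_indicator_one measurableSet_Iic.compl]
  refine lintegral_congr_ae ?_
  filter_upwards [hm] with y hy
  have hiff := lt_abs_iSup_inv_mul_iff hb hy
  by_cases hyb : y ∈ (Iic b)ᶜ
  · rw [indicator_of_mem hyb, indicator_of_mem (show _ ∈ Ioi (1 : ℝ) from hiff.2 hyb)]
    rfl
  · rw [indicator_of_notMem hyb,
      indicator_of_notMem (show _ ∉ Ioi (1 : ℝ) from fun h => hyb (hiff.1 h))]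

lemma measure_compl_Iic_homogeneousLift_ne_top {S : Type*} [MeasurableSpace S] {μ : Measure S}
    {α : ℝ} (hα : 0 < α) {f : ι → S → ℝ} (hf : ∀ j, MemLp (f j) (ENNReal.ofReal α) μ)
    (hp : ∀ᵐ y ∂homogeneousLift α (μ.map fun s j => f j s), 0 ≤ y)
    {b : ι → ℝ} (hb : ∀ j, 0 < b j) :
    homogeneousLift α (μ.map fun s j => f j s) (Iic b)ᶜ ≠ ∞ := by
  -- A point of the orthant outside the box satisfies `∑ j, y j / b j > 1`.
  refine ne_top_of_le_ne_top (lintegral_homogeneousLift_linear_ne_top hα hf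
    (ψ := (Ioi (1 : ℝ)).indicator 1) (measurable_one.indicator measurableSet_Ioi) (by simp)
    (by rw [lintegral_indicator_one measurableSet_Ioi]; exact radialMeasure_Ioi_one_ne_top hα)
    fun j => (b j)⁻¹) ?_
  rw [← lintegral_indicator_one measurableSet_Iic.compl]
  refine lintegral_mono_ae ?_
  filter_upwards [hp] with y hy
  have hnn : ∀ j, 0 ≤ (b j)⁻¹ * y j := fun j => mul_nonneg (inv_nonneg.2 (hb j).le) (hy j)
  by_cases hyb : y ∈ (Iic b)ᶜ
  · have hlt : 1 < |∑ j, (b j)⁻¹ * y j| := by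
      rw [abs_of_nonneg (Finset.sum_nonneg fun j _ => hnn j)]
      obtain ⟨j, hj⟩ := not_forall.1 hyb
      refine lt_of_lt_of_le ?_ (Finset.single_le_sum (fun j _ => hnn j) (Finset.mem_univ j))
      exact lt_of_not_ge fun h => hj ((inv_mul_le_one₀ (hb j)).1 h)
    rw [indicator_of_mem hyb, indicator_of_mem (show _ ∈ Ioi (1 : ℝ) from hlt)]
    rfl
  · simp [indicator_of_notMem hyb]

lemma ae_nonneg_map {S : Type*} [MeasurableSpace S] {μ : Measure S} {f : ι → S → ℝ}
    (hF : AEMeasurable (fun s j => f j s) μ) (h : ∀ j, ∀ᵐ s ∂μ, 0 ≤ f j s) :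
    ∀ᵐ x ∂μ.map (fun s j => f j s), 0 ≤ x :=
  (ae_map_iff hF measurableSet_Ici).2 (ae_all_iff.2 h)

lemma measurable_iSup_mul (a : ι → ℝ) : Measurable fun y : ι → ℝ => ⨆ j, a j * y j :=
  Measurable.iSup fun j => by fun_prop

end

theorem theorem3p1
    {S₁ S₂ : Type*} [MeasurableSpace S₁] [MeasurableSpace S₂]
    (μ₁ : Measure S₁) (μ₂ : Measure S₂)
    (α : ℝ) (hα₀ : 0 < α) (hα₂ : α < 2)
    (n : ℕ) (f₁ : Fin n → S₁ → ℝ) (f₂ : Fin n → S₂ → ℝ)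
    (hf₁ : ∀ j, MemLp (f₁ j) (ENNReal.ofReal α) μ₁)
    (hf₂ : ∀ j, MemLp (f₂ j) (ENNReal.ofReal α) μ₂)
    (hf₁_nonneg : ∀ j, ∀ᵐ s ∂μ₁, 0 ≤ f₁ j s)
    (hf₂_nonneg : ∀ j, ∀ᵐ s ∂μ₂, 0 ≤ f₂ j s) :
    (∀ a : Fin n → ℝ,
        eLpNorm (fun s => ∑ j, a j * f₁ j s) (ENNReal.ofReal α) μ₁
          = eLpNorm (fun s => ∑ j, a j * f₂ j s) (ENNReal.ofReal α) μ₂) ↔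
    (∀ a : Fin n → ℝ, (∀ j, 0 ≤ a j) →
        eLpNorm (fun s => ⨆ j, a j * f₁ j s) (ENNReal.ofReal α) μ₁
          = eLpNorm (fun s => ⨆ j, a j * f₂ j s) (ENNReal.ofReal α) μ₂) := by
  have hF₁ : AEMeasurable (fun s j => f₁ j s) μ₁ :=
    aemeasurable_pi_lambda _ fun j => (hf₁ j).aestronglyMeasurable.aemeasurable
  have hF₂ : AEMeasurable (fun s j => f₂ j s) μ₂ :=
    aemeasurable_pi_lambda _ fun j => (hf₂ j).aestronglyMeasurable.aemeasurable
  have hp₁ := homogeneousLift_nonneg α (ae_nonneg_map hF₁ hf₁_nonneg)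
  have hp₂ := homogeneousLift_nonneg α (ae_nonneg_map hF₂ hf₂_nonneg)
  have hz₁ := homogeneousLift_ne_zero α (μ₁.map fun s j => f₁ j s)
  have hz₂ := homogeneousLift_ne_zero α (μ₂.map fun s j => f₂ j s)
  have hcos : Measurable fun r : ℝ => ENNReal.ofReal (1 - Real.cos r) := by fun_prop
  have hcos_top := lintegral_radialMeasure_one_sub_cos_ne_top hα₀ hα₂
  have hcos_zero : ∫⁻ r, ENNReal.ofReal (1 - Real.cos r) ∂radialMeasure α ≠ 0 := by
    refine lintegral_radialMeasure_ne_zero α hcos le_rfl Real.pi_pos fun r hr => ?_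
    have : Real.cos r < Real.cos 0 :=
      Real.cos_lt_cos_of_nonneg_of_le_pi le_rfl hr.2.le hr.1
    simpa using this
  have hind : Measurable ((Ioi (1 : ℝ)).indicator (1 : ℝ → ℝ≥0∞)) :=
    measurable_one.indicator measurableSet_Ioi
  have hind_top : ∫⁻ r, (Ioi (1 : ℝ)).indicator 1 r ∂radialMeasure α ≠ ∞ := by
    rw [lintegral_indicator_one measurableSet_Ioi]
    exact radialMeasure_Ioi_one_ne_top hα₀
  have hind_zero : ∫⁻ r, (Ioi (1 : ℝ)).indicator 1 r ∂radialMeasure α ≠ 0 :=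
    lintegral_radialMeasure_ne_zero α hind zero_le_one one_lt_two fun r hr => by
      simp [hr.1]
  have hsum (a : Fin n → ℝ) := eLpNorm_comp_eq_iff hα₀ hF₁ hF₂
    (h := fun y => ∑ j, a j * y j) (by fun_prop)
    (fun r x _ => by simp [Finset.mul_sum, mul_left_comm]) hcos (by simp) hcos_zero hcos_top
  have hsup (a : Fin n → ℝ) := eLpNorm_comp_eq_iff hα₀ hF₁ hF₂
    (h := fun y => ⨆ j, a j * y j) (measurable_iSup_mul a)
    (fun r x hr => by simp [Real.mul_iSup_of_nonneg hr, mul_left_comm]) hind (by simp)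
    hind_zero hind_top
  constructor
  · intro h a _
    have hL : ∀ L : StrongDual ℝ (Fin n → ℝ), ∃ a : Fin n → ℝ, ∀ y, L y = ∑ j, a j * y j :=
      fun L => ⟨fun j => L (Pi.single j 1), fun y => by
        conv_lhs => rw [pi_eq_sum_univ' y]
        simp [mul_comm]⟩
    refine (hsup a).2 ?_
    rw [eq_of_lintegral_one_sub_cos hz₁ hz₂ hp₁ hp₂ (fun L => ?_) fun L => ?_]
    · obtain ⟨a, ha⟩ := hL L
      simp only [ha]
      simpa using lintegral_homogeneousLift_linear_ne_top hα₀ hf₁ hcos (by simp) hcos_top a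
    · obtain ⟨a, ha⟩ := hL L
      simp only [ha]
      simpa using (hsum a).1 (h a)
  · intro h a
    refine (hsum a).2 ?_
    rw [eq_of_measure_compl_Iic hz₁ hz₂ hp₁ hp₂
      (fun b hb => measure_compl_Iic_homogeneousLift_ne_top hα₀ hf₁ hp₁ hb) fun b hb => ?_]
    rw [← lintegral_indicator_iSup hp₁ hb, ← lintegral_indicator_iSup hp₂ hb]
    exact (hsup _).1 (h _ fun j => inv_nonneg.2 (hb j).le)
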